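/- Let $d\ge 1$, let $\mathbb T=\mathbb R/\mathbb Z$, and let $f:\mathbb T^d\to\mathbb R$ be a (Lebesgue) measurable function. For a frequency $\alpha\in\mathbb T^d$ and a phase $x\in\mathbb T^d$, let $H_x=H_{f,\alpha,x}$ be the discrete Schrödinger operator on $\ell^2(\mathbb Z^d)$, $$(H_xu)_n=\sum_{|m-n|=1}u_m+f(T^nx)\,u_n,\qquad T^nx=(x_1+n_1\alpha_1,\dots,x_d+n_d\alpha_d),\quad |m|=\sum_{j=1}^d|m_j|,$$ with domain $\{u\in\ell^2(\mathbb Z^d): (f(T^nx)u_n)_{n}\in\ell^2(\mathbb Z^d)\}$ (all of $\ell^2(\mathbb Z^d)$ if $f$ is bounded). Then there is a dense $G_\delta$ set $G\subset\mathbb T^d$, consisting of $\alpha$ all of whose coordinates are irrational, such that for every $\alpha\in G$ and for Lebesgue-a.e. $x\in\mathbb T^d$ the operator $H_x$ has empty point spectrum, i.e. it has no eigenvalues. -/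

import Mathlib

open MeasureTheory

/-- The lattice `ℤ^d`. -/
abbrev IntLattice (d : ℕ) : Type := Fin d → ℤ

/-- The Hilbert space `ℓ²(ℤ^d)` of square summable complex functions on the lattice. -/
abbrev EllTwo (d : ℕ) : Type := lp (fun _ : IntLattice d => ℂ) 2

/-- The hopping part of the operator: `(Δ u)_n = ∑_{|m - n| = 1} u_m`, where
`|k| = ∑ j, |k_j|`.  The sum has exactly `2 d` terms, see `hopping_eq_sum`. -/
noncomputable def hopping {d : ℕ} (u : IntLattice d → ℂ) (n : IntLattice d) : ℂ :=
  ∑ᶠ m ∈ {m : IntLattice d | ∑ j, |m j - n j| = 1}, u m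

/-- The vector `± e_i`. -/
def unitStep {d : ℕ} (p : Fin d × Bool) : IntLattice d :=
  Pi.single p.1 (if p.2 then 1 else -1)

theorem unitStep_injective {d : ℕ} : Function.Injective (unitStep (d := d)) := by
  rintro ⟨i, b⟩ ⟨j, c⟩ h
  have hi := congrFun h i
  by_cases hij : i = j
  · subst hij
    cases b <;> cases c <;> simp [unitStep] at hi ⊢
  · exfalso
    cases b <;> cases c <;> simp [unitStep, hij] at hi

theorem norm_one_iff {d : ℕ} (k : IntLattice d) :
    ∑ j, |k j| = 1 ↔ k ∈ Set.range (unitStep (d := d)) := by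
  constructor
  · intro h
    have hne : ∃ i, k i ≠ 0 := by
      by_contra hcon
      push Not at hcon
      simp [hcon] at h
    obtain ⟨i, hi⟩ := hne
    have h1 : 1 ≤ |k i| := Int.one_le_abs hi
    have hsplit := Finset.add_sum_erase Finset.univ (fun j => |k j|) (Finset.mem_univ i)
    have hnn : 0 ≤ ∑ j ∈ Finset.univ.erase i, |k j| := Finset.sum_nonneg fun j _ => abs_nonneg _
    have hz : ∑ j ∈ Finset.univ.erase i, |k j| = 0 := by
      omega
    have hki : |k i| = 1 := by
      omega
    have hzero : ∀ j, j ≠ i → k j = 0 := by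
      intro j hj
      have := (Finset.sum_eq_zero_iff_of_nonneg (fun j _ => abs_nonneg (k j))).1 hz j
        (Finset.mem_erase.2 ⟨hj, Finset.mem_univ j⟩)
      exact abs_eq_zero.1 this
    rcases (abs_eq (by norm_num : (0 : ℤ) ≤ 1)).1 hki with h' | h'
    · refine ⟨(i, true), funext fun j => ?_⟩
      by_cases hj : j = i
      · subst hj; simp [unitStep, h']
      · simp [unitStep, hj, hzero j hj]
    · refine ⟨(i, false), funext fun j => ?_⟩
      by_cases hj : j = i
      · subst hj; simp [unitStep, h']
      · simp [unitStep, hj, hzero j hj]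
  · rintro ⟨⟨i, b⟩, rfl⟩
    rw [Finset.sum_eq_single i]
    · cases b <;> simp [unitStep]
    · intro j _ hj
      simp [unitStep, hj]
    · simp

theorem hopping_eq_sum {d : ℕ} (u : IntLattice d → ℂ) (n : IntLattice d) :
    hopping u n = ∑ p : Fin d × Bool, u (n + unitStep p) := by
  have hs : {m : IntLattice d | ∑ j, |m j - n j| = 1} =
      Set.range fun p : Fin d × Bool => n + unitStep p := by
    ext m
    have := norm_one_iff (m - n)
    simp only [Pi.sub_apply, Set.mem_range] at this
    simp only [Set.mem_ofPred_eq, Set.mem_range, this]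
    exact exists_congr fun p => by rw [eq_sub_iff_add_eq, add_comm]
  have hinj : Function.Injective fun p : Fin d × Bool => n + unitStep p :=
    (add_right_injective n).comp unitStep_injective
  rw [hopping, hs, finsum_mem_range hinj, finsum_eq_sum_of_fintype]

theorem hopping_add {d : ℕ} (u w : IntLattice d → ℂ) (n : IntLattice d) :
    hopping (u + w) n = hopping u n + hopping w n := by
  simp only [hopping_eq_sum, Pi.add_apply, Finset.sum_add_distrib]

theorem hopping_smul {d : ℕ} (c : ℂ) (u : IntLattice d → ℂ) (n : IntLattice d) :
    hopping (c • u) n = c * hopping u n := by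
  simp only [hopping_eq_sum, Pi.smul_apply, smul_eq_mul, Finset.mul_sum]

theorem memLp_hopping {d : ℕ} (u : EllTwo d) : Memℓp (hopping (u : IntLattice d → ℂ)) 2 := by
  have h : hopping (u : IntLattice d → ℂ) =
      fun n => ∑ p : Fin d × Bool, (u : IntLattice d → ℂ) (n + unitStep p) :=
    funext fun n => hopping_eq_sum _ n
  rw [h]
  refine Memℓp.finsetSum Finset.univ fun p _ => ?_
  have hu := lp.memℓp u
  rw [memℓp_gen_iff (by norm_num)] at hu ⊢
  exact hu.comp_injective (add_left_injective (unitStep p))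

/-- The discrete Schrödinger operator on `ℓ²(ℤ^d)` with real potential `v`,
`(H u)_n = ∑_{|m - n| = 1} u_m + v_n u_n`, on its natural (maximal) domain
`{u ∈ ℓ² : v u ∈ ℓ²}`, which is the whole space when `v` is bounded. -/
noncomputable def schrodinger {d : ℕ} (v : IntLattice d → ℝ) : EllTwo d →ₗ.[ℂ] EllTwo d where
  domain :=
    { carrier := {u | Memℓp (fun n => (v n : ℂ) * u n) 2}
      zero_mem' := by
        have h : (fun n => (v n : ℂ) * (0 : EllTwo d) n) = 0 := by
          funext n; simp
        simpa only [Set.mem_ofPred_eq, h] using zero_memℓp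
      add_mem' := by
        intro a b ha hb
        have h : (fun n => (v n : ℂ) * (a + b) n) =
            (fun n => (v n : ℂ) * a n) + fun n => (v n : ℂ) * b n := by
          funext n; simp [mul_add]
        simpa only [Set.mem_ofPred_eq, h] using ha.add hb
      smul_mem' := by
        intro c a ha
        have h : (fun n => (v n : ℂ) * (c • a) n) = c • fun n => (v n : ℂ) * a n := by
          funext n; simp [mul_left_comm]
        simpa only [Set.mem_ofPred_eq, h] using ha.const_smul c }
  toFun :=
    { toFun := fun u =>
        ⟨fun n => hopping (u.1 : IntLattice d → ℂ) n + (v n : ℂ) * u.1 n,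
          (memLp_hopping u.1).add u.2⟩
      map_add' := by
        intro a b
        ext n
        change hopping ((a.1 : IntLattice d → ℂ) + (b.1 : IntLattice d → ℂ)) n + (v n : ℂ) * (a.1 n + b.1 n) =
          (hopping a.1 n + (v n : ℂ) * a.1 n) + (hopping b.1 n + (v n : ℂ) * b.1 n)
        rw [hopping_add]
        ring
      map_smul' := by
        intro c a
        ext n
        change hopping (c • (a.1 : IntLattice d → ℂ)) n + (v n : ℂ) * (c * a.1 n) =
          c * (hopping a.1 n + (v n : ℂ) * a.1 n)
        rw [hopping_smul]
        ring }

theorem mem_schrodinger_domain {d : ℕ} (v : IntLattice d → ℝ) (u : EllTwo d) :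
    u ∈ (schrodinger v).domain ↔ Memℓp (fun n => (v n : ℂ) * u n) 2 :=
  Iff.rfl

theorem schrodinger_apply {d : ℕ} (v : IntLattice d → ℝ) (u : (schrodinger v).domain)
    (n : IntLattice d) :
    (schrodinger v u) n = hopping (u.1 : IntLattice d → ℂ) n + (v n : ℂ) * u.1 n :=
  rfl

/-- The point spectrum of a (possibly unbounded) operator: the set of its eigenvalues. -/
def pointSpectrum {E : Type*} [AddCommGroup E] [Module ℂ E] (A : E →ₗ.[ℂ] E) : Set ℂ :=
  {z | ∃ u : A.domain, u ≠ 0 ∧ A u = z • (u : E)}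

/-- The shift `T^n x = (x_1 + n_1 α_1, …, x_d + n_d α_d)` on the torus `(ℝ/ℤ)^d`. -/
def torusShift {d : ℕ} (α : UnitAddTorus (Fin d)) (n : IntLattice d) (x : UnitAddTorus (Fin d)) :
    UnitAddTorus (Fin d) :=
  fun j => x j + n j • α j

/-- The quasiperiodic Schrödinger operator `H_x` with potential `f`, frequency `α` and phase `x`:
`(H_x u)_n = ∑_{|m - n| = 1} u_m + f(T^n x) u_n`. -/
noncomputable def quasiperiodicH {d : ℕ} (f : UnitAddTorus (Fin d) → ℝ)
    (α x : UnitAddTorus (Fin d)) : EllTwo d →ₗ.[ℂ] EllTwo d :=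
  schrodinger fun n => f (torusShift α n x)

/-! If all coordinates of `α` are rational, the potential is periodic for every phase, and a
periodic operator has no square summable eigenfunction. Indeed, the translates of an eigenfunction
by the period lattice would give of order `K ^ d` sites in a cube of side `q * K` that each carry a
fixed mass, while solutions on the cube are determined by a boundary layer of order `K ^ (d - 1)`
sites (`eq_zero_of_periodic`).

To pass to generic `α`, absence of eigenvalues is replaced by countably many conditions that are
open in the potential: for all `E` in a disc, `δ_m` is nearly of the form `(H - E) w` with `w`
finitely supported (`approxRange`). Such a `w` forces an eigenfunction to be small at `m`, and
periodic potentials satisfy every condition by duality.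

As `f` is only measurable, the sampled potential depends on `α` continuously only in measure. The
condition is therefore imposed outside an event of small probability. This gives open sets of
frequencies that contain the dense set of rational ones, and Baire's theorem applies. -/

/-! ### Dimension count for determined spaces -/

/-- If the elements of a space `V` of square summable functions are determined on `B` by their values
on a finite set `S`, then at most `S.card / c` points of `B` carry a mass at least `c` of some unit
vector of `V`. -/
theorem card_mul_le_card_of_determined {ι : Type*} (V : Submodule ℂ (lp (fun _ : ι => ℂ) 2))
    (S : Finset ι) (B : Set ι)
    (hV : ∀ u ∈ V, (∀ n ∈ S, (u : ι → ℂ) n = 0) → ∀ n ∈ B, (u : ι → ℂ) n = 0)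
    (Q : Finset ι) (hQ : ∀ n ∈ Q, n ∈ B) (c : ℝ)
    (h : ∀ n ∈ Q, ∃ u ∈ V, ‖u‖ ≤ 1 ∧ c ≤ ‖(u : ι → ℂ) n‖ ^ 2) :
    Q.card * c ≤ S.card := by
  classical
  choose! u huV hu1 huc using h
  let F : Submodule ℂ (lp (fun _ : ι => ℂ) 2) := Submodule.span ℂ (Q.image u : Set _)
  have hFV : F ≤ V := by
    refine Submodule.span_le.2 ?_
    intro x hx
    obtain ⟨n, hn, rfl⟩ := Finset.mem_image.1 (Finset.mem_coe.1 hx)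
    exact huV n hn
  have : FiniteDimensional ℂ F := FiniteDimensional.span_finset ℂ _
  let R : F →ₗ[ℂ] (S → ℂ) :=
    { toFun := fun x s => (x : lp (fun _ : ι => ℂ) 2) s
      map_add' := fun x y => by ext s; simp
      map_smul' := fun a x => by ext s; simp }
  -- Vectors in `ker R` vanish on `B`, so projecting onto `W` keeps the values on `B` and does not
  -- increase the norm, while `dim W ≤ S.card`.
  let W : Submodule ℂ F := (LinearMap.ker R)ᗮ
  have hker : ∀ x ∈ LinearMap.ker R, ∀ n ∈ B, (x : lp (fun _ : ι => ℂ) 2) n = 0 := by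
    intro x hx
    refine hV x (hFV x.2) fun n hn => ?_
    have := congrFun (LinearMap.mem_ker.1 hx) ⟨n, hn⟩
    simpa [R] using this
  have hWcard : Module.finrank ℂ W ≤ S.card := by
    have hinj : Function.Injective (R ∘ₗ W.subtype) := by
      rw [← LinearMap.ker_eq_bot, Submodule.eq_bot_iff]
      intro x hx
      have h1 : (x : F) ∈ LinearMap.ker R := by simpa using hx
      have h2 : (x : F) ∈ (LinearMap.ker R) ⊓ (LinearMap.ker R)ᗮ := ⟨h1, x.2⟩
      rw [Submodule.inf_orthogonal_eq_bot] at h2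
      exact Subtype.ext (by simpa using h2)
    simpa using LinearMap.finrank_le_finrank_of_injective hinj
  let b := stdOrthonormalBasis ℂ W
  -- The sum is the squared norm of evaluation at `n` on `W`. Summing it over `n ∈ Q` gives at most
  -- the trace of the identity, `dim W`.
  have hpt : ∀ n ∈ Q, c ≤ ∑ i, ‖((b i : F) : lp (fun _ : ι => ℂ) 2) n‖ ^ 2 := by
    intro n hn
    have huF : u n ∈ F := Submodule.subset_span (Finset.mem_coe.2 (Finset.mem_image_of_mem u hn))
    obtain ⟨k, hk, a, ha, hka⟩ :=
      (LinearMap.ker R).exists_add_mem_mem_orthogonal (⟨u n, huF⟩ : F)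
    have hnorm : ‖a‖ ≤ 1 := by
      have hp := norm_add_sq_eq_norm_sq_add_norm_sq_of_inner_eq_zero k a 
        (Submodule.inner_right_of_mem_orthogonal hk ha)
      rw [← hka] at hp
      have h1 : ‖(⟨u n, huF⟩ : F)‖ ≤ 1 := hu1 n hn
      nlinarith [norm_nonneg (⟨u n, huF⟩ : F), norm_nonneg k, norm_nonneg a]
    have hval : u n n = (a : lp (fun _ : ι => ℂ) 2) n := by
      have h1 : u n = (k : lp (fun _ : ι => ℂ) 2) + a := congrArg Subtype.val hka
      have h2 := congrArg (fun z : lp (fun _ : ι => ℂ) 2 => z n) h1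
      simpa [hker k hk n (hQ n hn)] using h2
    have hexp : (a : lp (fun _ : ι => ℂ) 2) n =
        ∑ i, inner ℂ (b i) (⟨a, ha⟩ : W) * ((b i : F) : lp (fun _ : ι => ℂ) 2) n := by
      have h1 := b.sum_repr' (⟨a, ha⟩ : W)
      have h2 := congrArg (fun z : W => ((z : F) : lp (fun _ : ι => ℂ) 2) n) h1
      simp only at h2
      rw [← h2]
      simp only [Submodule.coe_sum, Submodule.coe_smul, lp.coeFn_sum, lp.coeFn_smul]
      exact Finset.sum_apply _ _ _
    have hpars : ∑ i, ‖inner ℂ (b i) (⟨a, ha⟩ : W)‖ ^ 2 ≤ 1 := by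
      rw [b.sum_sq_norm_inner_right]
      have : ‖(⟨a, ha⟩ : W)‖ ≤ 1 := hnorm
      nlinarith [norm_nonneg (⟨a, ha⟩ : W)]
    calc c ≤ ‖u n n‖ ^ 2 := huc n hn
      _ = ‖∑ i, inner ℂ (b i) (⟨a, ha⟩ : W) * ((b i : F) : lp (fun _ : ι => ℂ) 2) n‖ ^ 2 := by
        rw [hval, hexp]
      _ ≤ (∑ i, ‖inner ℂ (b i) (⟨a, ha⟩ : W)‖ * ‖((b i : F) : lp (fun _ : ι => ℂ) 2) n‖) ^ 2 := by
        gcongr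
        exact (norm_sum_le _ _).trans_eq (by simp only [norm_mul])
      _ ≤ (∑ i, ‖inner ℂ (b i) (⟨a, ha⟩ : W)‖ ^ 2) *
          ∑ i, ‖((b i : F) : lp (fun _ : ι => ℂ) 2) n‖ ^ 2 := Finset.sum_mul_sq_le_sq_mul_sq _ _ _
      _ ≤ 1 * ∑ i, ‖((b i : F) : lp (fun _ : ι => ℂ) 2) n‖ ^ 2 := by gcongr
      _ = _ := one_mul _
  calc (Q.card : ℝ) * c = ∑ n ∈ Q, c := by simp
    _ ≤ ∑ n ∈ Q, ∑ i, ‖((b i : F) : lp (fun _ : ι => ℂ) 2) n‖ ^ 2 := Finset.sum_le_sum hpt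
    _ = ∑ i, ∑ n ∈ Q, ‖((b i : F) : lp (fun _ : ι => ℂ) 2) n‖ ^ 2 := Finset.sum_comm
    _ ≤ ∑ i, 1 := by
      refine Finset.sum_le_sum fun i _ => ?_
      have h1 := lp.sum_rpow_le_norm_rpow (p := 2) (by norm_num)
        ((b i : F) : lp (fun _ : ι => ℂ) 2) Q
      have h2 : ‖((b i : F) : lp (fun _ : ι => ℂ) 2)‖ = 1 := b.orthonormal.1 i
      rw [h2] at h1
      simpa using h1
    _ ≤ S.card := by simpa using (Nat.cast_le (α := ℝ)).2 hWcard

/-! ### Unique continuation from the boundary layer of a cube -/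

/-- The cube `∏ j, [m_j, m_j + N)`. -/
noncomputable def cube {d : ℕ} (m : IntLattice d) (N : ℕ) : Finset (IntLattice d) :=
  Fintype.piFinset fun j => Finset.Ico (m j) (m j + N)

/-- The points of a cube with a coordinate in one of its first two or in its last layer. -/
noncomputable def cubeLayer {d : ℕ} (m : IntLattice d) (N : ℕ) : Finset (IntLattice d) :=
  {n ∈ cube m N | ∃ j, n j ∈ ({m j, m j + 1, m j + N - 1} : Finset ℤ)}

theorem card_cubeLayer_le {d : ℕ} (m : IntLattice d) (N : ℕ) :
    (cubeLayer m N).card ≤ 3 * d * N ^ (d - 1) := by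
  classical
  have hsub : cubeLayer m N ⊆ Finset.univ.biUnion fun j : Fin d =>
      ({m j, m j + 1, m j + N - 1} : Finset ℤ).biUnion fun t =>
        Fintype.piFinset (Function.update (fun j => Finset.Ico (m j) (m j + N)) j {t}) := by
    intro n hn
    obtain ⟨hn, j, hj⟩ := Finset.mem_filter.1 hn
    rw [cube, Fintype.mem_piFinset] at hn
    refine Finset.mem_biUnion.2 ⟨j, Finset.mem_univ j, Finset.mem_biUnion.2 ⟨n j, hj, ?_⟩⟩
    rw [Fintype.mem_piFinset]
    intro i
    by_cases hij : i = j
    · subst hij; simp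
    · simpa [hij] using hn i
  refine (Finset.card_le_card hsub).trans ?_
  refine (Finset.card_biUnion_le_card_mul _ _ (3 * N ^ (d - 1)) fun j _ => ?_).trans_eq
    (by simp; ring)
  refine (Finset.card_biUnion_le_card_mul _ _ (N ^ (d - 1)) fun t _ => ?_).trans
    (Nat.mul_le_mul_right _ Finset.card_le_three)
  rw [Fintype.card_piFinset, ← Finset.mul_prod_erase _ _ (Finset.mem_univ j)]
  rw [Finset.prod_congr rfl (g := fun _ => N)]
  · simp
  · intro i hi
    simp [(Finset.mem_erase.1 hi).1]

/-- A solution of the difference equation that vanishes on the boundary layer of a cube vanishes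
on the cube. -/
theorem eq_zero_on_cube {d : ℕ} (hd : 1 ≤ d) (v : IntLattice d → ℝ) (E : ℂ) (u : IntLattice d → ℂ)
    (hu : ∀ n, hopping u n + (v n : ℂ) * u n = E * u n) (m : IntLattice d) (N : ℕ)
    (h0 : ∀ n ∈ cubeLayer m N, u n = 0) : ∀ n ∈ cube m N, u n = 0 := by
  classical
  let i : Fin d := ⟨0, hd⟩
  -- Induction on slices in direction `i`: the equation at `n' = n - e_i` gives `u n` from `u n'`
  -- and the other neighbours of `n'`, which lie in lower slices. The site `n - 2 e_i` is why two
  -- lower layers are needed.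
  have key : ∀ k : ℕ, ∀ n ∈ cube m N, n i < m i + k → u n = 0 := by
    intro k
    induction k with
    | zero =>
      intro n hn hlt
      have := Fintype.mem_piFinset.1 hn i
      rw [Finset.mem_Ico] at this
      simp at hlt; omega
    | succ k ih =>
      intro n hn hlt
      by_cases hl : n ∈ cubeLayer m N
      · exact h0 n hl
      have hint : ∀ j, m j + 2 ≤ n j ∧ n j + 2 ≤ m j + N := by
        intro j
        have h1 := Finset.mem_Ico.1 (Fintype.mem_piFinset.1 hn j)
        have h2 : n j ∉ ({m j, m j + 1, m j + N - 1} : Finset ℤ) := fun h =>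
          hl (Finset.mem_filter.2 ⟨hn, j, h⟩)
        simp only [Finset.mem_insert, Finset.mem_singleton, not_or] at h2
        omega
      set n' : IntLattice d := n - unitStep (i, true) with hn'
      have hmem : ∀ w : IntLattice d, (∀ j, -2 ≤ w j ∧ w j ≤ 1) → w i ≤ -1 → u (n + w) = 0 := by
        intro w hw hwi
        refine ih _ (Fintype.mem_piFinset.2 fun j => Finset.mem_Ico.2 ?_) ?_
        · have := hint j; have := hw j
          simp only [Pi.add_apply]; omega
        · push_cast at hlt
          simp only [Pi.add_apply]; omega
      have hn0 : u n' = 0 := by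
        rw [hn', sub_eq_add_neg]
        refine hmem _ (fun j => ?_) ?_
        · by_cases hj : j = i
          · subst hj; simp [unitStep]
          · simp [unitStep, hj]
        · simp [unitStep]
      have heq := hu n'
      rw [hn0, mul_zero, mul_zero, add_zero, hopping_eq_sum,
        Finset.sum_eq_single (i, true)] at heq
      · simpa [hn'] using heq
      · rintro ⟨j, s⟩ - hp
        rw [hn', sub_add_eq_add_sub, add_sub_assoc]
        refine hmem _ (fun l => ?_) ?_
        · by_cases hj : l = i <;> by_cases hl : l = j <;> cases s <;>
            simp [unitStep, Pi.single_apply, hj, hl] <;> split_ifs <;> norm_num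
        · by_cases hj : i = j
          · subst hj
            cases s
            · simp [unitStep]
            · exact absurd rfl hp
          · cases s <;> simp [unitStep, hj]
      · simp
  intro n hn
  refine key N n hn ?_
  exact (Finset.mem_Ico.1 (Fintype.mem_piFinset.1 hn i)).2

/-! ### Periodic potentials have no eigenfunctions -/

/-- Translation of a square summable function on the lattice. -/
noncomputable def EllTwo.translate {d : ℕ} (u : EllTwo d) (k : IntLattice d) : EllTwo d :=
  ⟨fun n => u (n - k), by
    have hu := lp.memℓp u
    change Memℓp (fun n => (u : IntLattice d → ℂ) (n - k)) 2
    rw [memℓp_gen_iff (by norm_num)] at hu ⊢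
    exact hu.comp_injective (sub_left_injective (b := k))⟩

theorem EllTwo.translate_apply {d : ℕ} (u : EllTwo d) (k n : IntLattice d) :
    u.translate k n = u (n - k) := rfl

theorem EllTwo.norm_translate {d : ℕ} (u : EllTwo d) (k : IntLattice d) :
    ‖u.translate k‖ = ‖u‖ := by
  rw [lp.norm_eq_tsum_rpow (by norm_num), lp.norm_eq_tsum_rpow (by norm_num)]
  congr 1
  exact (Equiv.subRight k).tsum_eq fun n => ‖u n‖ ^ (2 : ENNReal).toReal

/-- The square summable solutions of `H u = E u`. -/
noncomputable def solutionSpace {d : ℕ} (v : IntLattice d → ℝ) (E : ℂ) :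
    Submodule ℂ (EllTwo d) where
  carrier := {u | ∀ n, hopping (u : IntLattice d → ℂ) n + (v n : ℂ) * u n = E * u n}
  zero_mem' := fun n => by
    rw [lp.coeFn_zero, hopping_eq_sum]; simp
  add_mem' := fun {a b} ha hb n => by
    rw [lp.coeFn_add, hopping_add, Pi.add_apply]
    linear_combination ha n + hb n
  smul_mem' := fun c a ha n => by
    rw [lp.coeFn_smul, hopping_smul, Pi.smul_apply, smul_eq_mul]
    linear_combination c * ha n

/-- A Schrödinger operator with periodic potential has no square summable eigenfunctions. -/
theorem eq_zero_of_periodic {d : ℕ} (hd : 1 ≤ d) (v : IntLattice d → ℝ) (q : ℕ) (hq : 0 < q)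
    (hv : ∀ n k : IntLattice d, v (n + (q : ℤ) • k) = v n) (E : ℂ) (u : EllTwo d)
    (hu : ∀ n, hopping (u : IntLattice d → ℂ) n + (v n : ℂ) * u n = E * u n) : u = 0 := by
  classical
  by_contra hne
  have hnorm : 0 < ‖u‖ := norm_pos_iff.2 hne
  obtain ⟨m, hm⟩ : ∃ m, u m ≠ 0 := by
    by_contra hcon
    push Not at hcon
    exact hne (lp.ext (funext hcon))
  set c : ℝ := (‖u m‖ / ‖u‖) ^ 2 with hc
  have hcpos : 0 < c := by have := norm_pos_iff.2 hm; positivity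
  -- The count gives `K ^ d * c ≤ 3 * d * (q * K) ^ (d - 1)`; dividing by `K ^ (d - 1)` leaves a
  -- bound on `K`.
  have hbound : ∀ K : ℕ, 0 < K → (K : ℝ) * c ≤ 3 * d * q ^ (d - 1) := by
    intro K hK
    let Q : Finset (IntLattice d) :=
      (Fintype.piFinset fun _ : Fin d => Finset.Ico (0 : ℤ) K).image fun k => m + (q : ℤ) • k
    have hinj : Function.Injective fun k : IntLattice d => m + (q : ℤ) • k := by
      intro k l hkl
      funext j
      have := congrFun hkl j
      simpa [hq.ne'] using this
    have hQcard : Q.card = K ^ d := by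
      rw [Finset.card_image_of_injective _ hinj, Fintype.card_piFinset]
      simp
    have h1 := card_mul_le_card_of_determined (solutionSpace v E) (cubeLayer m (q * K))
      (cube m (q * K)) (fun w hw h0 n hn => eq_zero_on_cube hd v E w hw m (q * K) h0 n hn) Q
      (by
        intro n hn
        obtain ⟨k, hk, rfl⟩ := Finset.mem_image.1 hn
        refine Fintype.mem_piFinset.2 fun j => Finset.mem_Ico.2 ?_
        have := Finset.mem_Ico.1 (Fintype.mem_piFinset.1 hk j)
        have hq' : (0 : ℤ) < q := by exact_mod_cast hq
        simp only [Pi.add_apply, Pi.smul_apply, smul_eq_mul]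
        push_cast
        constructor <;> nlinarith) c (by
        intro n hn
        obtain ⟨k, hk, rfl⟩ := Finset.mem_image.1 hn
        refine ⟨((‖u‖ : ℂ)⁻¹) • u.translate ((q : ℤ) • k), Submodule.smul_mem _ _ ?_, ?_, ?_⟩
        · intro n
          have := hu (n - (q : ℤ) • k)
          rw [← hv (n - (q : ℤ) • k) k, sub_add_cancel] at this
          rw [EllTwo.translate_apply, ← this, hopping_eq_sum, hopping_eq_sum]
          simp only [EllTwo.translate_apply, sub_add_eq_add_sub]
        · rw [norm_smul, EllTwo.norm_translate, norm_inv, Complex.norm_real, norm_norm,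
            inv_mul_cancel₀ hnorm.ne']
        · rw [lp.coeFn_smul, Pi.smul_apply, EllTwo.translate_apply, norm_smul, norm_inv,
            Complex.norm_real, norm_norm, add_sub_cancel_right, hc, div_eq_inv_mul])
    have h2 : ((cubeLayer m (q * K)).card : ℝ) ≤ 3 * d * (q * K) ^ (d - 1) := by
      exact_mod_cast card_cubeLayer_le m (q * K)
    have h3 := h1.trans h2
    rw [hQcard, mul_pow] at h3
    have h4 : (K : ℝ) ^ d = K ^ (d - 1) * K := by rw [← pow_succ, Nat.sub_add_cancel hd]
    push_cast at h3
    rw [h4] at h3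
    have hK' : (0 : ℝ) < (K : ℝ) ^ (d - 1) := by positivity
    refine le_of_mul_le_mul_left ?_ hK'
    calc _ = (K : ℝ) ^ (d - 1) * K * c := by ring
      _ ≤ _ := h3
      _ = _ := by ring
  obtain ⟨K, hK⟩ := exists_nat_gt (3 * d * (q : ℝ) ^ (d - 1) / c)
  rw [div_lt_iff₀ hcpos] at hK
  have := hbound (K + 1) (Nat.succ_pos K)
  push_cast at this
  linarith

/-! ### An open condition that excludes eigenfunctions -/

/-- The residual `δ_m - (H - E) w`. -/
noncomputable def deltaResidual {d : ℕ} (v : IntLattice d → ℝ) (E : ℂ) (m : IntLattice d)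
    (w : IntLattice d →₀ ℂ) (n : IntLattice d) : ℂ :=
  Pi.single (M := fun _ => ℂ) m 1 n - (hopping w n + ((v n : ℂ) - E) * w n)

/-- A finite set outside of which the residual vanishes. -/
noncomputable def residualSupport {d : ℕ} (m : IntLattice d) (w : IntLattice d →₀ ℂ) :
    Finset (IntLattice d) :=
  insert m (w.support ∪ Finset.univ.biUnion fun p : Fin d × Bool =>
    w.support.image fun n => n - unitStep p)

/-- The potentials for which `δ_m` is, for all `E` in a disc of radius `M`, up to `ε` in the image
of the finitely supported functions under `H - E`. -/
def approxRange {d : ℕ} (m : IntLattice d) (M ε : ℝ) : Set (IntLattice d → ℝ) :=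
  {v | ∀ E ∈ Metric.closedBall (0 : ℂ) M, ∃ w : IntLattice d →₀ ℂ,
    ∑ n ∈ residualSupport m w, ‖deltaResidual v E m w n‖ ^ 2 < ε}

/-- For fixed `w` the residual sum depends continuously on `(v, E)`, through finitely many
coordinates of `v`. Compactness of the disc gives one neighbourhood of `v` although `w` varies with
`E`. -/
theorem isOpen_approxRange {d : ℕ} (m : IntLattice d) (M ε : ℝ) :
    IsOpen (approxRange m M ε) := by
  rw [isOpen_iff_eventually]
  intro v hv
  refine (isCompact_closedBall (0 : ℂ) M).eventually_forall_of_forall_eventually fun E hE => ?_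
  obtain ⟨w, hw⟩ := hv E hE
  have hcont : Continuous fun z : (IntLattice d → ℝ) × ℂ =>
      ∑ n ∈ residualSupport m w, ‖deltaResidual z.1 z.2 m w n‖ ^ 2 := by
    unfold deltaResidual
    fun_prop
  filter_upwards [hcont.continuousAt.eventually (gt_mem_nhds hw)] with z hz
  exact ⟨w, hz⟩

theorem hopping_eq_sum_sub {d : ℕ} (u : IntLattice d → ℂ) (n : IntLattice d) :
    hopping u n = ∑ p : Fin d × Bool, u (n - unitStep p) := by
  let σ : Equiv.Perm (Fin d × Bool) := (Equiv.refl (Fin d)).prodCongr Equiv.boolNot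
  rw [hopping_eq_sum, ← Equiv.sum_comp σ]
  refine Finset.sum_congr rfl fun p _ => ?_
  obtain ⟨i, b⟩ := p
  cases b <;> simp [σ, unitStep, sub_eq_add_neg, ← Pi.single_neg]

/-- Summation by parts against a finitely supported function. -/
theorem sum_hopping_mul {d : ℕ} (u : IntLattice d → ℂ) (w : IntLattice d →₀ ℂ) :
    ∑ᶠ n, hopping w n * u n = ∑ᶠ n, w n * hopping u n := by
  have hfin : ∀ p : Fin d × Bool, (Function.support fun n => w (n + unitStep p) * u n).Finite := by
    intro p
    refine ((w.hasFiniteSupport).preimage (f := fun n => n + unitStep p)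
      (add_left_injective _).injOn).subset fun n hn => ?_
    exact left_ne_zero_of_mul hn
  have hfin' : ∀ p : Fin d × Bool, (Function.support fun n => w n * u (n - unitStep p)).Finite := by
    intro p
    exact w.hasFiniteSupport.subset fun n hn => left_ne_zero_of_mul hn
  simp only [hopping_eq_sum w, hopping_eq_sum_sub u, Finset.sum_mul, Finset.mul_sum]
  rw [finsum_sum_comm _ _ fun p _ => hfin p, finsum_sum_comm _ _ fun p _ => hfin' p]
  refine Finset.sum_congr rfl fun p _ => ?_
  rw [← finsum_comp_equiv (Equiv.addRight (unitStep p))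
    (f := fun n => w n * u (n - unitStep p))]
  simp

/-- Pair `u` with `δ_m = residual + (H - E) w`. The pairing is bilinear, without conjugation, so the
last term vanishes even for complex `E`; Cauchy–Schwarz bounds the rest. -/
theorem norm_sq_apply_le_of_mem_approxRange {d : ℕ} (v : IntLattice d → ℝ) (m : IntLattice d)
    (M ε : ℝ) (hv : v ∈ approxRange m M ε) (E : ℂ) (hE : ‖E‖ ≤ M) (u : EllTwo d)
    (hu : ∀ n, hopping (u : IntLattice d → ℂ) n + (v n : ℂ) * u n = E * u n) :
    ‖u m‖ ^ 2 ≤ ε * ‖u‖ ^ 2 := by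
  classical
  obtain ⟨w, hw⟩ := hv E (by simpa using hE)
  set S := residualSupport m w with hS
  have hwS : ∀ n ∉ S, w n = 0 := by
    intro n hn
    by_contra h
    exact hn (by simp [hS, residualSupport, h])
  have hhS : ∀ n ∉ S, hopping w n = 0 := by
    intro n hn
    rw [hopping_eq_sum]
    refine Finset.sum_eq_zero fun p _ => ?_
    by_contra h
    refine hn (Finset.mem_insert_of_mem (Finset.mem_union_right _ (Finset.mem_biUnion.2
      ⟨p, Finset.mem_univ p, Finset.mem_image.2 ⟨n + unitStep p, ?_, by simp⟩⟩)))
    simpa using h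
  have hparts : ∑ n ∈ S, hopping w n * u n = ∑ n ∈ S, w n * hopping (u : IntLattice d → ℂ) n := by
    rw [← finsum_eq_sum_of_support_subset, ← finsum_eq_sum_of_support_subset, sum_hopping_mul]
    · intro n hn
      by_contra h
      exact hn (by simp [hwS n h])
    · intro n hn
      by_contra h
      exact hn (by simp [hhS n h])
  have hval : u m = ∑ n ∈ S, deltaResidual v E m w n * u n := by
    have h1 : ∑ n ∈ S, Pi.single (M := fun _ => ℂ) m 1 n * u n = u m := by
      rw [Finset.sum_eq_single m]
      · simp
      · intro n _ hn; simp [hn]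
      · intro h; exact absurd (Finset.mem_insert_self _ _) h
    simp only [deltaResidual, sub_mul, add_mul, Finset.sum_sub_distrib, Finset.sum_add_distrib]
    rw [h1, hparts]
    have h2 : ∑ n ∈ S, w n * hopping (u : IntLattice d → ℂ) n =
        ∑ n ∈ S, E * w n * u n - ∑ n ∈ S, (v n : ℂ) * w n * u n := by
      rw [← Finset.sum_sub_distrib]
      refine Finset.sum_congr rfl fun n _ => ?_
      linear_combination w n * hu n
    rw [h2]; ring
  calc ‖u m‖ ^ 2 = ‖∑ n ∈ S, deltaResidual v E m w n * u n‖ ^ 2 := by rw [hval]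
    _ ≤ (∑ n ∈ S, ‖deltaResidual v E m w n‖ * ‖u n‖) ^ 2 := by
      gcongr
      exact (norm_sum_le _ _).trans_eq (by simp only [norm_mul])
    _ ≤ (∑ n ∈ S, ‖deltaResidual v E m w n‖ ^ 2) * ∑ n ∈ S, ‖u n‖ ^ 2 :=
      Finset.sum_mul_sq_le_sq_mul_sq _ _ _
    _ ≤ ε * ‖u‖ ^ 2 := by
      have h3 := lp.sum_rpow_le_norm_rpow (p := 2) (by norm_num) u S
      simp only [ENNReal.toReal_ofNat, Real.rpow_ofNat] at h3
      have hε : 0 ≤ ε := (Finset.sum_nonneg fun n _ => by positivity).trans hw.le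
      gcongr

/-- For a periodic potential the finitely supported functions have dense image under `H - E`. -/
theorem mem_approxRange_of_periodic {d : ℕ} (hd : 1 ≤ d) (v : IntLattice d → ℝ) (q : ℕ)
    (hq : 0 < q) (hv : ∀ n k : IntLattice d, v (n + (q : ℤ) • k) = v n) (m : IntLattice d)
    (M ε : ℝ) (hε : 0 < ε) : v ∈ approxRange m M ε := by
  classical
  intro E _
  let e : IntLattice d → EllTwo d := fun n => lp.single 2 n (1 : ℂ)
  -- This is `(H - E) δ_n`. Orthogonality to all of these vectors is the eigenvalue equation at
  -- `conj E`.
  let b : IntLattice d → EllTwo d := fun n =>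
    ∑ p, e (n + unitStep p) + ((v n : ℂ) - E) • e n
  have hinner : ∀ n (u : EllTwo d), inner ℂ (e n) u = u n := by
    intro n u
    simp [e, lp.inner_single_left]
  have hbot : (Submodule.span ℂ (Set.range b))ᗮ = ⊥ := by
    rw [Submodule.eq_bot_iff]
    intro u hu
    refine eq_zero_of_periodic hd v q hq hv (starRingEnd ℂ E) u fun n => ?_
    have h1 : inner ℂ (b n) u = 0 :=
      Submodule.inner_right_of_mem_orthogonal (Submodule.subset_span (Set.mem_range_self n)) hu
    simp only [b, inner_add_left, sum_inner, inner_smul_left, hinner, map_sub,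
      Complex.conj_ofReal] at h1
    rw [hopping_eq_sum]
    linear_combination h1
  have hcl : e m ∈ (Submodule.span ℂ (Set.range b)).topologicalClosure := by
    rw [Submodule.topologicalClosure_eq_top_iff.2 hbot]; trivial
  obtain ⟨x, hx, hdist⟩ := Metric.mem_closure_iff.1 hcl (Real.sqrt ε) (Real.sqrt_pos.2 hε)
  obtain ⟨w, rfl⟩ := (Finsupp.mem_span_range_iff_exists_finsupp).1 hx
  refine ⟨w, ?_⟩
  have hcoord : ∀ n, deltaResidual v E m w n = (e m - w.sum fun i a => a • b i : EllTwo d) n := by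
    intro n
    have he : ∀ i, inner ℂ (e n) (e i) = if i = n then (1 : ℂ) else 0 := by
      intro i
      rw [hinner, lp.single_apply, Pi.single_apply]
      simp only [eq_comm]
    have hm : Pi.single (M := fun _ => ℂ) m 1 n = if m = n then (1 : ℂ) else 0 := by
      rw [Pi.single_apply]
      simp only [eq_comm]
    have hstep : ∀ p : Fin d × Bool,
        (w.sum fun i a => a * if i + unitStep p = n then (1 : ℂ) else 0) = w (n - unitStep p) := by
      intro p
      simpa [← eq_sub_iff_add_eq, Finsupp.sum] using Eq.symm
    rw [← hinner, inner_sub_right, he, deltaResidual, hm, hopping_eq_sum_sub, Finsupp.sum,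
      inner_sum]
    simp only [b, inner_smul_right, inner_add_right, inner_sum, he, mul_add, Finset.mul_sum,
      Finset.sum_add_distrib]
    rw [Finset.sum_comm]
    simp only [Finsupp.sum] at hstep
    simp only [hstep]
    congr 2
    rw [Finset.sum_eq_single n]
    · simp [mul_comm]
    · intro i _ hi; simp [hi]
    · intro hn; simp [Finsupp.notMem_support_iff.1 hn]
  simp only [hcoord]
  have h3 := lp.sum_rpow_le_norm_rpow (p := 2) (by norm_num)
    (e m - w.sum fun i a => a • b i) (residualSupport m w)
  simp only [ENNReal.toReal_ofNat, Real.rpow_ofNat] at h3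
  refine h3.trans_lt ?_
  rw [dist_eq_norm] at hdist
  calc _ < Real.sqrt ε ^ 2 := by gcongr
    _ = ε := Real.sq_sqrt hε.le

/-! ### Dependence on the frequency, in measure -/

open Filter Topology Set

/-- Coordinatewise convergence in measure does not increase, in the limit, the measure of the
set where a random sequence fails to lie in a given open set. -/
theorem eventually_measure_notMem_lt {X A ι : Type*} [MeasurableSpace X] [Countable ι]
    {μ : Measure X} [IsFiniteMeasure μ] {l : Filter A} {F : A → X → ι → ℝ} {F₀ : X → ι → ℝ}
    (hF₀ : Measurable F₀)
    (hF : ∀ i, TendstoInMeasure μ (fun a x => F a x i) l (fun x => F₀ x i))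
    {O : Set (ι → ℝ)} (hO : IsOpen O) {δ : ENNReal} (hδ : μ {x | F₀ x ∉ O} < δ) :
    ∀ᶠ a in l, μ {x | F a x ∉ O} < δ := by
  obtain ⟨e, he⟩ := exists_injective_nat ι
  have hfin : ∀ k, {i | e i ≤ k}.Finite := fun k => (finite_Iic k).preimage he.injOn
  let near : ℕ → (ι → ℝ) → (ι → ℝ) → Prop := fun k y z =>
    ∀ i, e i ≤ k → |y i - z i| < 1 / ((k : ℝ) + 1)
  -- Open neighbourhoods of the complement of `O` that see finitely many coordinates. They decrease
  -- to a subset of this closed set, so continuity from above makes `F₀ ⁻¹' bad k` of measure less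
  -- than `δ` for some `k`.
  let bad : ℕ → Set (ι → ℝ) := fun k => {z | ∃ y, y ∉ O ∧ near k y z}
  have hbadopen : ∀ k, IsOpen (bad k) := by
    intro k
    have : bad k = ⋃ y ∈ Oᶜ, ⋂ i ∈ {i | e i ≤ k}, {z | |y i - z i| < 1 / ((k : ℝ) + 1)} := by
      ext z; simp [bad, near]
    rw [this]
    refine isOpen_biUnion fun y _ => (hfin k).isOpen_biInter fun i _ => ?_
    exact isOpen_lt (by fun_prop) continuous_const
  have hanti : Antitone fun k => F₀ ⁻¹' bad k := by
    rintro k k' hkk' x ⟨y, hy, hn⟩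
    refine ⟨y, hy, fun i hi => (hn i (hi.trans hkk')).trans_le ?_⟩
    gcongr
  have hinter : ⋂ k, F₀ ⁻¹' bad k ⊆ {x | F₀ x ∉ O} := by
    intro x hx hxO
    obtain ⟨I, u, hu, hsub⟩ := isOpen_pi_iff.1 hO _ hxO
    have hloc : ∀ i ∈ I, ∃ η > 0, ∀ t, |t - F₀ x i| < η → t ∈ u i := fun i hi => by
      obtain ⟨η, hη, hb⟩ := Metric.isOpen_iff.1 (hu i hi).1 _ (hu i hi).2
      exact ⟨η, hη, fun t ht => hb (by rwa [Metric.mem_ball, Real.dist_eq])⟩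
    have hev : ∀ᶠ k : ℕ in atTop, ∀ i ∈ I, e i ≤ k ∧ ∀ t,
        |t - F₀ x i| < 1 / ((k : ℝ) + 1) → t ∈ u i := by
      rw [Filter.eventually_all_finset]
      intro i hi
      obtain ⟨η, hη, hb⟩ := hloc i hi
      filter_upwards [eventually_ge_atTop (e i),
        tendsto_one_div_add_atTop_nhds_zero_nat.eventually (gt_mem_nhds hη)] with k hk hk'
      exact ⟨hk, fun t ht => hb t (ht.trans hk')⟩
    obtain ⟨k, hk⟩ := hev.exists
    obtain ⟨y, hy, hn⟩ := mem_iInter.1 hx k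
    exact hy (hsub fun i hi => (hk i hi).2 _ (hn i (hk i hi).1))
  have hlim := tendsto_measure_iInter_atTop (μ := μ)
    (fun k => (hF₀ (hbadopen k).measurableSet).nullMeasurableSet) hanti ⟨0, measure_ne_top _ _⟩
  obtain ⟨k, hk⟩ := (hlim.eventually
    (gt_mem_nhds ((measure_mono hinter).trans_lt hδ))).exists
  have hsum : Tendsto (fun a => μ (F₀ ⁻¹' bad k) + ∑ i ∈ (hfin k).toFinset,
      μ {x | ENNReal.ofReal (1 / ((k : ℝ) + 1)) ≤ edist (F a x i) (F₀ x i)}) l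
      (𝓝 (μ (F₀ ⁻¹' bad k))) := by
    have h1 := tendsto_finsetSum (hfin k).toFinset fun i _ =>
      hF i (ENNReal.ofReal (1 / ((k : ℝ) + 1))) (by simp; positivity)
    simpa using h1.const_add (μ (F₀ ⁻¹' bad k))
  filter_upwards [hsum.eventually (gt_mem_nhds hk)] with a ha
  refine lt_of_le_of_lt ?_ ha
  -- If `F a x ∉ O`, then `F₀ x` is bad, or one of finitely many coordinates has moved by at least
  -- `1 / (k + 1)`.
  refine le_trans (measure_mono (t := F₀ ⁻¹' bad k ∪ ⋃ i ∈ (hfin k).toFinset,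
    {x | ENNReal.ofReal (1 / ((k : ℝ) + 1)) ≤ edist (F a x i) (F₀ x i)}) ?_)
    ((measure_union_le _ _).trans (add_le_add_right (measure_biUnion_finset_le _ _) _))
  intro x hx
  by_cases hb : F₀ x ∈ bad k
  · exact Or.inl hb
  · right
    by_contra hcon
    refine hb ⟨F a x, hx, fun i hi => ?_⟩
    simp only [mem_iUnion, not_exists] at hcon
    have h1 := hcon i ((hfin k).mem_toFinset.2 hi)
    simp only [mem_ofPred_eq, not_le, edist_dist, Real.dist_eq] at h1
    exact (ENNReal.ofReal_lt_ofReal_iff (by positivity)).1 h1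

/-- Translations of a bounded function act continuously with respect to convergence in measure. -/
theorem tendstoInMeasure_comp_add_right {G : Type*} [AddGroup G] [TopologicalSpace G]
    [IsTopologicalAddGroup G] [CompactSpace G] [R1Space G] [MeasurableSpace G] [BorelSpace G]
    (μ : Measure G) [IsFiniteMeasure μ] [μ.InnerRegularCompactLTTop] [μ.IsAddRightInvariant]
    {g : G → ℝ} (hg : MemLp g 1 μ) (b : G) :
    TendstoInMeasure μ (fun a x => g (x + a)) (𝓝 b) (fun x => g (x + b)) := by
  let T : G → C(G, G) := fun a => ⟨fun x => x + a, by fun_prop⟩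
  have hT : Continuous T := ContinuousMap.continuous_of_continuous_uncurry _
    (by change Continuous fun p : G × G => p.2 + p.1; fun_prop)
  have hmp : ∀ a, MeasurePreserving (T a) μ μ := fun a => measurePreserving_add_right μ a
  -- Translation is continuous in `L¹`, and `L¹` convergence implies convergence in measure.
  have h := tendstoInMeasure_of_tendsto_Lp
    ((continuousAt_const (y := hg.toLp g)).compMeasurePreservingLp (z := b) hT.continuousAt hmp
      ENNReal.one_ne_top)
  have hae : ∀ a, Lp.compMeasurePreserving (T a) (hmp a) (hg.toLp g) =ᵐ[μ] fun x => g (x + a) := by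
    intro a
    refine (Lp.coeFn_compMeasurePreserving _ (hmp a)).trans ?_
    exact (hmp a).quasiMeasurePreserving.ae_eq_comp hg.coeFn_toLp
  exact h.congr (fun a => hae a) (hae b)

theorem Real.isEmbedding_arctan : IsEmbedding Real.arctan :=
  Real.arctan_strictMono.isEmbedding_of_ordConnected (by
    rw [Real.range_arctan]; exact ordConnected_Ioo)

/-- The set of frequencies for which the sampled potential lies in a given open set up to an event
of probability less than `δ` is open. -/
theorem isOpen_setOf_measure_sample_notMem_lt {d : ℕ} {f : UnitAddTorus (Fin d) → ℝ}
    (hf : AEMeasurable f volume) {O : Set (IntLattice d → ℝ)} (hO : IsOpen O) (δ : ENNReal) :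
    IsOpen {α : UnitAddTorus (Fin d) |
      volume {x : UnitAddTorus (Fin d) | (fun n => f (torusShift α n x)) ∉ O} < δ} := by
  have hshift : ∀ (α : UnitAddTorus (Fin d)) n,
      torusShift α n = fun x => x + fun j => n j • α j := fun α n => rfl
  have hmp : ∀ (α : UnitAddTorus (Fin d)) n, MeasurePreserving (torusShift α n) volume volume :=
    fun α n => by rw [hshift]; exact measurePreserving_add_right _ _
  -- `f` need not be integrable; its arctangent is bounded, and since `arctan` is an embedding the
  -- open condition `O` transfers to some open `O'`.
  let g : UnitAddTorus (Fin d) → ℝ := fun x => Real.arctan (hf.mk f x)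
  have hg : Measurable g := hf.measurable_mk.arctan
  have hgL : MemLp g 1 volume := by
    refine MemLp.of_bound hg.aestronglyMeasurable (Real.pi / 2) (Eventually.of_forall fun x => ?_)
    rw [Real.norm_eq_abs, abs_le]
    exact ⟨(Real.neg_pi_div_two_lt_arctan _).le, (Real.arctan_lt_pi_div_two _).le⟩
  obtain ⟨O', hO', hOO'⟩ := (IsInducing.piMap (ι := IntLattice d)
    fun _ => Real.isEmbedding_arctan.isInducing).isOpen_iff.1 hO
  have hmeas : ∀ α : UnitAddTorus (Fin d), volume {x : UnitAddTorus (Fin d) |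
      (fun n => f (torusShift α n x)) ∉ O} =
      volume {x : UnitAddTorus (Fin d) | (fun n => g (torusShift α n x)) ∉ O'} := by
    intro α
    refine measure_congr ?_
    have h1 : ∀ᵐ x : UnitAddTorus (Fin d) ∂volume, ∀ n,
        f (torusShift α n x) = hf.mk f (torusShift α n x) :=
      ae_all_iff.2 fun n => (hmp α n).quasiMeasurePreserving.ae_eq_comp hf.ae_eq_mk
    filter_upwards [h1] with x hx
    refine propext ?_
    change (fun n => f (torusShift α n x)) ∉ O ↔ (fun n => g (torusShift α n x)) ∉ O'
    rw [funext hx, ← hOO']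
    rfl
  simp only [hmeas]
  rw [isOpen_iff_eventually]
  intro α hα
  refine eventually_measure_notMem_lt
    (F := fun (β x : UnitAddTorus (Fin d)) (n : IntLattice d) => g (torusShift β n x))
    (measurable_pi_lambda _ fun n => hg.comp (hmp α n).measurable) (fun n => ?_) hO' hα
  have hc : Continuous fun (β : UnitAddTorus (Fin d)) j => n j • β j := by fun_prop
  intro ε hε
  exact (tendstoInMeasure_comp_add_right volume hgL (fun j => n j • α j) ε hε).comp (hc.tendsto α)

/-! ### Rational and irrational frequencies -/

theorem dense_setOf_forall_rat (d : ℕ) :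
    Dense {α : UnitAddTorus (Fin d) | ∀ j, ∃ r : ℚ, α j = ((r : ℝ) : UnitAddCircle)} := by
  have h1 : DenseRange fun r : ℚ => ((r : ℝ) : UnitAddCircle) :=
    (QuotientAddGroup.mk_surjective.denseRange).comp Rat.denseRange_cast
      (AddCircle.continuous_mk' 1)
  refine (dense_pi univ fun (_ : Fin d) _ => h1).mono fun α hα j => ?_
  obtain ⟨r, hr⟩ := hα j (mem_univ j)
  exact ⟨r, hr.symm⟩

/-- Sampling along a rational frequency gives a periodic potential. -/
theorem exists_period_of_forall_rat {d : ℕ} (α : UnitAddTorus (Fin d))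
    (hα : ∀ j, ∃ r : ℚ, α j = ((r : ℝ) : UnitAddCircle)) :
    ∃ q : ℕ, 0 < q ∧ ∀ (x : UnitAddTorus (Fin d)) (n k : IntLattice d),
      torusShift α (n + (q : ℤ) • k) x = torusShift α n x := by
  choose r hr using hα
  refine ⟨∏ j, (r j).den, Finset.prod_pos fun j _ => (r j).pos, fun x n k => ?_⟩
  have hz : ∀ j, ((∏ j, (r j).den : ℕ) : ℤ) • α j = 0 := by
    intro j
    obtain ⟨c, hc⟩ := Finset.dvd_prod_of_mem (fun j => (r j).den) (Finset.mem_univ j)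
    have h1 : (((r j).den : ℕ) : ℤ) • α j = 0 := by
      rw [hr j, ← AddCircle.coe_zsmul, AddCircle.coe_eq_zero_iff]
      refine ⟨(r j).num, ?_⟩
      have : ((r j).den : ℝ) * (r j : ℝ) = (r j).num := by
        exact_mod_cast Rat.den_mul_eq_num (r j)
      simp [this]
    rw [hc, Nat.cast_mul, mul_comm, mul_smul, h1, smul_zero]
  funext j
  simp only [torusShift, Pi.add_apply, Pi.smul_apply, smul_eq_mul, add_smul]
  rw [mul_comm, mul_smul, hz, smul_zero, add_zero]

theorem isOpen_dense_setOf_apply_ne {d : ℕ} (j : Fin d) (t : UnitAddCircle) :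
    IsOpen {α : UnitAddTorus (Fin d) | α j ≠ t} ∧ Dense {α : UnitAddTorus (Fin d) | α j ≠ t} := by
  refine ⟨isOpen_ne_fun (continuous_apply j) continuous_const, ?_⟩
  have : Nontrivial UnitAddCircle := by
    refine ⟨((1 / 2 : ℝ) : UnitAddCircle), 0, fun h => ?_⟩
    obtain ⟨n, hn⟩ := (AddCircle.coe_eq_zero_iff 1).1 h
    have h2 : ((2 * n : ℤ) : ℝ) = 1 := by
      rw [zsmul_eq_mul] at hn; push_cast; linarith
    have : 2 * n = 1 := by exact_mod_cast h2
    omega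
  have h : Dense ({t}ᶜ : Set UnitAddCircle) := dense_compl_singleton t
  exact h.preimage (isOpenMap_eval j)

/-! ### Baire category argument -/

theorem theorem1p3 (d : ℕ) (hd : 1 ≤ d) (f : UnitAddTorus (Fin d) → ℝ)
    (hf : AEMeasurable f volume) :
    ∃ G : Set (UnitAddTorus (Fin d)), IsGδ G ∧ Dense G ∧
      (∀ α ∈ G, ∀ (j : Fin d) (q : ℚ), α j ≠ ((q : ℝ) : UnitAddCircle)) ∧
      ∀ α ∈ G, ∀ᵐ x : UnitAddTorus (Fin d) ∂volume,
        pointSpectrum (quasiperiodicH f α x) = ∅ := by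
  -- The indices are the site, the radius of the energy disc, the accuracy and the bound on the
  -- failure probability. At a rational frequency the failure event is empty.
  let U : IntLattice d × ℕ × ℕ × ℕ → Set (UnitAddTorus (Fin d)) := fun p =>
    {α | volume {x : UnitAddTorus (Fin d) | (fun n => f (torusShift α n x)) ∉
      approxRange p.1 p.2.1 (1 / ((p.2.2.1 : ℝ) + 1))} < ((p.2.2.2 : ENNReal) + 1)⁻¹}
  let I : Fin d × ℚ → Set (UnitAddTorus (Fin d)) := fun p => {α | α p.1 ≠ ((p.2 : ℝ) : UnitAddCircle)}
  have hUo : ∀ p, IsOpen (U p) := fun p =>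
    isOpen_setOf_measure_sample_notMem_lt hf (isOpen_approxRange _ _ _) _
  have hUd : ∀ p, Dense (U p) := fun p => by
    refine (dense_setOf_forall_rat d).mono fun α hα => ?_
    obtain ⟨q, hq, hper⟩ := exists_period_of_forall_rat α hα
    have : {x : UnitAddTorus (Fin d) | (fun n => f (torusShift α n x)) ∉
        approxRange p.1 p.2.1 (1 / ((p.2.2.1 : ℝ) + 1))} = ∅ := by
      refine eq_empty_iff_forall_notMem.2 fun x hx => hx ?_
      exact mem_approxRange_of_periodic hd _ q hq (fun n k => by rw [hper]) _ _ _ (by positivity)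
    change volume _ < _
    rw [this, measure_empty]
    simp
  have hIo : ∀ p, IsOpen (I p) := fun p => (isOpen_dense_setOf_apply_ne _ _).1
  have hId : ∀ p, Dense (I p) := fun p => (isOpen_dense_setOf_apply_ne _ _).2
  refine ⟨(⋂ p, U p) ∩ ⋂ p, I p, (IsGδ.iInter_of_isOpen hUo).inter (IsGδ.iInter_of_isOpen hIo),
    (dense_iInter_of_isOpen hUo hUd).inter_of_Gδ (IsGδ.iInter_of_isOpen hUo)
      (IsGδ.iInter_of_isOpen hIo) (dense_iInter_of_isOpen hIo hId),
    fun α hα j q => mem_iInter.1 hα.2 (j, q), fun α hα => ?_⟩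
  have hae : ∀ᵐ x : UnitAddTorus (Fin d) ∂volume, ∀ (m : IntLattice d) (M k : ℕ),
      (fun n => f (torusShift α n x)) ∈ approxRange m M (1 / ((k : ℝ) + 1)) := by
    refine ae_all_iff.2 fun m => ae_all_iff.2 fun M => ae_all_iff.2 fun k => ?_
    -- The failure probability is below `1 / (j + 1)` for every `j`, hence zero.
    refine le_antisymm (ENNReal.le_of_forall_pos_le_add fun ε hε _ => ?_) zero_le
    obtain ⟨j, hj⟩ := ENNReal.exists_inv_nat_lt (ENNReal.coe_pos.2 hε).ne'
    have h1 : volume {x : UnitAddTorus (Fin d) | (fun n => f (torusShift α n x)) ∉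
        approxRange m M (1 / ((k : ℝ) + 1))} < ((j : ENNReal) + 1)⁻¹ :=
      mem_iInter.1 hα.1 (m, M, k, j)
    rw [zero_add]
    exact h1.le.trans ((ENNReal.inv_le_inv.2 le_self_add).trans hj.le)
  filter_upwards [hae] with x hx
  refine eq_empty_iff_forall_notMem.2 ?_
  rintro E ⟨u, hu0, hu⟩
  refine hu0 (Subtype.ext (lp.ext (funext fun m => ?_)))
  obtain ⟨M, hM⟩ := exists_nat_ge ‖E‖
  have heq : ∀ n, hopping ((u : EllTwo d) : IntLattice d → ℂ) n +
      (f (torusShift α n x) : ℂ) * (u : EllTwo d) n = E * (u : EllTwo d) n := fun n => by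
    have := congrArg (fun w : EllTwo d => w n) hu
    exact this
  have hle : ∀ k : ℕ, ‖(u : EllTwo d) m‖ ^ 2 ≤ 1 / ((k : ℝ) + 1) * ‖(u : EllTwo d)‖ ^ 2 :=
    fun k => norm_sq_apply_le_of_mem_approxRange _ m M _ (hx m M k) E hM u heq
  have h0 : ‖(u : EllTwo d) m‖ ^ 2 ≤ 0 := by
    have := ge_of_tendsto' (tendsto_one_div_add_atTop_nhds_zero_nat.mul_const
      (‖(u : EllTwo d)‖ ^ 2)) hle
    simpa using this
  have := pow_eq_zero_iff (two_ne_zero) |>.1 (le_antisymm h0 (sq_nonneg _))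
  simpa using this
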